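/- Let $G$ be a compact (Hausdorff) group with normalized Haar measure $d\sigma$, and let $(\mu_t)_{t\ge 0}$ be a vaguely (equivalently, weakly) continuous convolution semigroup of Borel probability measures on $G$ with $\mu_0=\delta_e$. Let $L^2(G)=L^2(G,\mathbb C)$, and for $t\ge 0$ let $T_t$ be the bounded operator on $L^2(G)$ which extends the operator $T_tf(\sigma)=\int_G f(\sigma\tau)\,\mu_t(d\tau)$, $f\in C(G)$. Let $L^2_c(G)=\{f\in L^2(G): f(g\sigma g^{-1})=f(\sigma)\text{ for every } g\in G\text{ and almost every }\sigma\in G\}$. Let $\widehat G$ be the set of equivalence classes of (continuous) irreducible unitary representations $\pi:G\to U(d_\pi)$, let $\chi_\pi=\operatorname{tr}\pi(\cdot)$ be the character of $\pi$, and $\widehat{\mu}(\pi)=\int_G\pi(\sigma)\,\mu(d\sigma)$. Suppose that every $\mu_t$, $t\ge0$, is central, i.e. $\mu_t(gAg^{-1})=\mu_t(A)$ for all $g\in G$ and all Borel sets $A$, and symmetric, i.e. $\mu_t(A^{-1})=\mu_t(A)$ for all Borel sets $A$. Then there are real numbers $\alpha_\pi\le 0$ $(\pi\in\widehat G)$ with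 $\widehat{\mu_t}(\pi)=e^{t\alpha_\pi}I_\pi$ for all $t\ge0$ and $\pi\in\widehat G$; the operators $T_t$ map $L^2_c(G)$ into itself; and $\{\chi_\pi:\pi\in\widehat G\}$ is a complete set of eigenvectors for the action of every $T_t$ on $L^2_c(G)$: the $\chi_\pi$ form a complete orthonormal system in $L^2_c(G)$ (they lie in $L^2_c(G)$, are orthonormal for distinct classes, and their closed linear span is $L^2_c(G)$), and $$T_t\chi_\pi=e^{t\alpha_\pi}\chi_\pi\qquad\text{for all }\pi\in\widehat G,\ t\ge 0.$$ -/

import Mathlib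

open MeasureTheory Measure
open scoped NNReal ENNReal

namespace CompactHunt

section Measures

variable {G : Type*} [Group G] [MeasurableSpace G]

/-- `μ` is central (conjugate-invariant): `μ (g A g⁻¹) = μ A` for all `g` and all Borel `A`. -/
def IsCentral (μ : Measure G) : Prop :=
  ∀ (g : G) (A : Set G), MeasurableSet A → μ ((fun x => g * x * g⁻¹) '' A) = μ A

/-- `μ` is symmetric: `μ (A⁻¹) = μ A` for all Borel `A`. -/
def IsSymmetric (μ : Measure G) : Prop :=
  ∀ A : Set G, MeasurableSet A → μ ((fun x => x⁻¹) '' A) = μ A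

/-- A (weakly, equivalently vaguely) continuous convolution semigroup of Borel probability
measures on a compact group with `μ₀ = δ_e`.  The identity `μ_{s+t} = μ_s * μ_t` is expressed
through the integrals of continuous functions, as usual on a locally compact group, so that no
countability assumption on the group is needed. -/
structure IsConvolutionSemigroup [TopologicalSpace G] [OpensMeasurableSpace G]
    (μ : ℝ≥0 → ProbabilityMeasure G) : Prop where
  zero : (μ 0 : Measure G) = Measure.dirac 1
  add : ∀ (s t : ℝ≥0) (f : C(G, ℂ)),
    ∫ x, f x ∂(μ (s + t) : Measure G) =
      ∫ x, (∫ y, f (x * y) ∂(μ t : Measure G)) ∂(μ s : Measure G)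
  continuous : Continuous μ

end Measures

section Dual

variable (G : Type*) [Group G] [TopologicalSpace G]

/-- The linear representation on `ℂ^d` given by a homomorphism into the unitary matrices. -/
noncomputable def unitaryRep {G : Type*} [Group G] {d : ℕ}
    (π : G →* Matrix.unitaryGroup (Fin d) ℂ) : Representation ℂ G (Fin d → ℂ) :=
  Matrix.toLinAlgEquiv'.toMonoidHom.comp ((Matrix.unitaryGroup (Fin d) ℂ).subtype.comp π)

/-- A continuous irreducible unitary matrix representation. -/
structure UnitaryIrrep where
  dim : ℕ
  toHom : G →* Matrix.unitaryGroup (Fin dim) ℂ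
  continuous_toHom : Continuous toHom
  irreducible : (unitaryRep toHom).IsIrreducible

variable {G}

namespace UnitaryIrrep

/-- The matrix `π(g)`. -/
def mat (π : UnitaryIrrep G) (g : G) : Matrix (Fin π.dim) (Fin π.dim) ℂ := (π.toHom g).1

/-- Equivalence of representations. -/
instance setoid : Setoid (UnitaryIrrep G) where
  r π π' := Nonempty ((unitaryRep π.toHom).Equiv (unitaryRep π'.toHom))
  iseqv :=
    { refl := fun _ => ⟨Representation.Equiv.refl _⟩
      symm := fun ⟨e⟩ => ⟨e.symm⟩
      trans := fun ⟨e⟩ ⟨e'⟩ => ⟨e.trans e'⟩ }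

/-- The character `χ_π(g) = tr π(g)` as a continuous function. -/
noncomputable def character (π : UnitaryIrrep G) : C(G, ℂ) where
  toFun g := (π.mat g).trace
  continuous_toFun := (continuous_subtype_val.comp π.continuous_toHom).matrix_trace

theorem character_eq_of_equiv {π π' : UnitaryIrrep G} (h : π ≈ π') :
    π.character = π'.character := by
  obtain ⟨e⟩ := h
  ext g
  have key : unitaryRep π'.toHom g = e.toLinearEquiv.conj (unitaryRep π.toHom g) := by
    refine LinearMap.ext fun v => ?_
    have h := LinearMap.congr_fun (e.toIntertwiningMap.isIntertwining' g) (e.toLinearEquiv.symm v)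
    have h' : e.toIntertwiningMap.toLinearMap (e.toLinearEquiv.symm v) = v :=
      e.toLinearEquiv.apply_symm_apply v
    rw [LinearMap.comp_apply, LinearMap.comp_apply, h'] at h
    rw [LinearEquiv.conj_apply_apply]
    exact h.symm
  have h1 : ∀ ρ : UnitaryIrrep G, LinearMap.trace ℂ _ (unitaryRep ρ.toHom g) = ρ.character g :=
    fun ρ => Matrix.trace_toLin'_eq (ρ.mat g)
  rw [← h1, ← h1, key, LinearMap.trace_conj']

/-- The Fourier transform `∫ π(g) μ(dg)` (entrywise integral). -/
noncomputable def fourier [MeasurableSpace G] (μ : Measure G) (π : UnitaryIrrep G) :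
    Matrix (Fin π.dim) (Fin π.dim) ℂ :=
  Matrix.of fun i j => ∫ g, π.mat g i j ∂μ

end UnitaryIrrep

variable (G) in
/-- The unitary dual `Ĝ`: equivalence classes of irreducible representations. -/
def UnitaryDual : Type _ := Quotient (UnitaryIrrep.setoid (G := G))

/-- The class of an irreducible representation. -/
def UnitaryDual.mk (π : UnitaryIrrep G) : UnitaryDual G := Quotient.mk _ π

/-- The character of a class of irreducible representations. -/
noncomputable def UnitaryDual.character (π : UnitaryDual G) : C(G, ℂ) :=
  Quotient.lift UnitaryIrrep.character (fun _ _ => UnitaryIrrep.character_eq_of_equiv) π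

end Dual

section L2

variable (G : Type*) [Group G] [TopologicalSpace G] [IsTopologicalGroup G] [CompactSpace G]
  [MeasurableSpace G] [BorelSpace G]

/-- Normalized Haar measure. -/
noncomputable def haarProb : Measure G := haarMeasure ⊤

instance : IsProbabilityMeasure (haarProb G) := ⟨by
  simpa [haarProb] using haarMeasure_self (K₀ := (⊤ : TopologicalSpace.PositiveCompacts G))⟩

instance : (haarProb G).IsHaarMeasure := by unfold haarProb; infer_instance

instance : (haarProb G).IsMulRightInvariant := ⟨fun g => by
  have : IsProbabilityMeasure (map (· * g) (haarProb G)) :=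
    isProbabilityMeasure_map (by fun_prop)
  have : (map (· * g) (haarProb G)).IsHaarMeasure := inferInstance
  exact isHaarMeasure_eq_of_isProbabilityMeasure _ _⟩

theorem measurePreserving_conj (g : G) :
    MeasurePreserving (fun x : G => g * x * g⁻¹) (haarProb G) (haarProb G) :=
  (measurePreserving_mul_right (haarProb G) g⁻¹).comp (measurePreserving_mul_left (haarProb G) g)

/-- The complex Hilbert space `L²(G)` of normalized Haar measure. -/
abbrev L2 : Type _ := Lp ℂ 2 (haarProb G)

/-- The subspace `L²_c(G)` of those `f` with `f (g σ g⁻¹) = f σ`, i.e. for every `g` this holds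
for almost every `σ`. -/
noncomputable def L2c : Submodule ℂ (L2 G) where
  carrier := {f | ∀ g : G, (fun x => f (g * x * g⁻¹)) =ᵐ[haarProb G] f}
  zero_mem' := fun g => by
    have h := Lp.coeFn_zero ℂ 2 (haarProb G)
    have h' := (measurePreserving_conj G g).quasiMeasurePreserving.ae h
    filter_upwards [h, h'] with x hx hx'
    rw [hx, hx']; rfl
  add_mem' := fun {f f'} hf hf' g => by
    have h := Lp.coeFn_add f f'
    have h' := (measurePreserving_conj G g).quasiMeasurePreserving.ae h
    filter_upwards [h, h', hf g, hf' g] with x hx hx' h1 h2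
    rw [hx, hx', Pi.add_apply, Pi.add_apply, h1, h2]
  smul_mem' := fun c f hf g => by
    have h := Lp.coeFn_smul c f
    have h' := (measurePreserving_conj G g).quasiMeasurePreserving.ae h
    filter_upwards [h, h', hf g] with x hx hx' h1
    rw [hx, hx', Pi.smul_apply, Pi.smul_apply, h1]

variable {G}

/-- A continuous function as an element of `L²(G)`. -/
noncomputable def toL2 : C(G, ℂ) →L[ℂ] L2 G := ContinuousMap.toLp 2 (haarProb G) ℂ

theorem denseRange_toL2 : DenseRange (toL2 (G := G)) :=
  ContinuousMap.toLp_denseRange ℂ (haarProb G) ℂ (by simp)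

theorem continuous_hunt (μ : ProbabilityMeasure G) (f : C(G, ℂ)) :
    Continuous fun x => ∫ y, f (x * y) ∂(μ : Measure G) := by
  let F : C(G × G, ℂ) := ⟨fun p => f (p.1 * p.2), by fun_prop⟩
  have h : ∀ g : C(G, ℂ), ∫ y, ContinuousMap.toLp 1 (μ : Measure G) ℂ g y ∂(μ : Measure G) =
      ∫ y, g y ∂(μ : Measure G) := fun g => integral_congr_ae (ContinuousMap.coeFn_toLp _ g)
  have hc : Continuous fun g : C(G, ℂ) => ∫ y, g y ∂(μ : Measure G) := by
    simp_rw [← h]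
    exact continuous_integral.comp (ContinuousMap.toLp 1 (μ : Measure G) ℂ).continuous
  exact hc.comp F.curry.continuous

/-- The operator `T f (σ) = ∫ f (σ τ) μ(dτ)` on `C(G)`. -/
noncomputable def huntC (μ : ProbabilityMeasure G) : C(G, ℂ) →ₗ[ℂ] C(G, ℂ) where
  toFun f := ⟨fun x => ∫ y, f (x * y) ∂(μ : Measure G), continuous_hunt μ f⟩
  map_add' f g := by
    ext x
    exact integral_add
      (Continuous.integrable_of_hasCompactSupport (by fun_prop) (.of_compactSpace _))
      (Continuous.integrable_of_hasCompactSupport (by fun_prop) (.of_compactSpace _))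
  map_smul' c f := by
    ext x
    exact integral_const_mul _ _

theorem norm_sq_toL2 (f : C(G, ℂ)) : ‖toL2 f‖ ^ 2 = ∫ x, ‖f x‖ ^ 2 ∂haarProb G := by
  have h : ((‖toL2 f‖ ^ 2 : ℝ) : ℂ) = ((∫ x, ‖f x‖ ^ 2 ∂haarProb G : ℝ) : ℂ) := by
    have h0 := inner_self_eq_norm_sq_to_K (𝕜 := ℂ) (toL2 f)
    have h1 := ContinuousMap.inner_toLp (𝕜 := ℂ) (haarProb G) f f
    rw [Complex.ofReal_pow]
    refine (h0.symm.trans h1).trans ?_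
    rw [← integral_complex_ofReal]
    refine integral_congr_ae (.of_forall fun x => ?_)
    simp [Complex.mul_conj, Complex.normSq_eq_norm_sq]
  exact_mod_cast h

/-- The `L²` contraction estimate for the operator on `C(G)`. -/
theorem norm_toL2_huntC_le (μ : ProbabilityMeasure G) (f : C(G, ℂ)) :
    ‖toL2 (huntC μ f)‖ ≤ ‖toL2 f‖ := by
  refine le_of_sq_le_sq ?_ (norm_nonneg _)
  rw [norm_sq_toL2, norm_sq_toL2]
  have hint : ∀ (ν : Measure G) [IsFiniteMeasure ν] {g : G → ℝ}, Continuous g → Integrable g ν :=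
    fun ν _ g hg => hg.integrable_of_hasCompactSupport (.of_compactSpace _)
  let F : C(G, ℝ) := ⟨fun x => ‖f x‖ ^ 2, by fun_prop⟩
  let F' : C(G, ℂ) := ⟨fun x => ((‖f x‖ ^ 2 : ℝ) : ℂ), by fun_prop⟩
  have hcont : Continuous fun x => ∫ y, ‖f (x * y)‖ ^ 2 ∂(μ : Measure G) := by
    have h := Complex.continuous_re.comp (continuous_hunt μ F')
    refine h.congr fun x => ?_
    have : ∫ y, F' (x * y) ∂(μ : Measure G) =
        ((∫ y, ‖f (x * y)‖ ^ 2 ∂(μ : Measure G) : ℝ) : ℂ) := integral_complex_ofReal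
    rw [Function.comp_apply, this, Complex.ofReal_re]
  calc ∫ x, ‖huntC μ f x‖ ^ 2 ∂haarProb G
      ≤ ∫ x, (∫ y, ‖f (x * y)‖ ^ 2 ∂(μ : Measure G)) ∂haarProb G := by
        refine integral_mono (hint _ (by fun_prop)) (hint _ hcont) fun x => ?_
        have h1 : ‖huntC μ f x‖ ≤ ∫ y, ‖f (x * y)‖ ∂(μ : Measure G) :=
          norm_integral_le_integral_norm _
        have h2 : (∫ y, ‖f (x * y)‖ ∂(μ : Measure G)) ^ 2 ≤
            ∫ y, ‖f (x * y)‖ ^ 2 ∂(μ : Measure G) :=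
          (even_two.convexOn_pow (𝕜 := ℝ)).map_integral_le (by fun_prop) isClosed_univ
            (by simp) (hint _ (by fun_prop)) (hint _ (by fun_prop))
        exact (pow_le_pow_left₀ (norm_nonneg _) h1 2).trans h2
    _ = ∫ y, (∫ x, ‖f (x * y)‖ ^ 2 ∂haarProb G) ∂(μ : Measure G) :=
        integral_integral_swap_of_hasCompactSupport (f := fun x y => ‖f (x * y)‖ ^ 2)
          (by fun_prop) (.of_compactSpace _)
    _ = ∫ x, ‖f x‖ ^ 2 ∂haarProb G := by
        simp_rw [integral_mul_right_eq_self (μ := haarProb G) (fun x => ‖f x‖ ^ 2)]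
        simp

/-- The operator `T` on `L²(G)`: the continuous extension of `huntC μ` along the dense inclusion
of `C(G)` in `L²(G)`. -/
noncomputable def hunt (μ : ProbabilityMeasure G) : L2 G →L[ℂ] L2 G :=
  (toL2.toLinearMap.comp (huntC μ)).extendOfNorm toL2.toLinearMap

/-- `hunt μ` does extend `huntC μ`. -/
theorem hunt_toL2 (μ : ProbabilityMeasure G) (f : C(G, ℂ)) :
    hunt μ (toL2 f) = toL2 (huntC μ f) :=
  LinearMap.extendOfNorm_eq denseRange_toL2
    ⟨1, fun f => by simpa using norm_toL2_huntC_le μ f⟩ f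

theorem norm_hunt_le (μ : ProbabilityMeasure G) : ‖hunt μ‖ ≤ 1 :=
  LinearMap.opNorm_extendOfNorm_le denseRange_toL2 zero_le_one
    (fun f => by simpa using norm_toL2_huntC_le μ f)

end L2

end CompactHunt

/-! The Fourier transform of a central measure commutes with every `π(g)`, so Schur's lemma makes it
a scalar (`fourier_eq_smul_one`). Multiplying by `π(x)` and taking traces turns this into the
eigenvalue equation for `χ_π` (`hunt_character`). Along the semigroup the scalar is continuous and
multiplicative in `t`, real by symmetry, and at most 1 in modulus because `hunt` contracts `L²`;
such a function of `t` is `exp (t a)` with `a ≤ 0` (`exists_multiplier_eq_exp`).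

Orthonormality of the characters is Schur orthogonality. Their completeness rests on Peter–Weyl
(`coefSpan_orthogonal`), obtained from the spectral theorem for compact self-adjoint convolution
operators: eigenspaces for nonzero eigenvalues are finite-dimensional, translation invariant and
made of continuous functions, hence lie in the span of matrix coefficients. For a class function,
the matrix of its inner products with the coefficients of `π` is again scalar by Schur, so
orthogonality to `χ_π` forces orthogonality to all coefficients of `π`
(`inner_coef_eq_zero_of_inner_character`). -/

namespace CompactHunt

/-! ### Irreducible unitary representations and Schur's lemma. -/

section Schur

variable {G : Type*} [Group G] [TopologicalSpace G]

namespace UnitaryIrrep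

open Matrix

theorem mat_one (π : UnitaryIrrep G) : π.mat 1 = 1 := by
  simp [mat]

theorem mat_mul (π : UnitaryIrrep G) (g h : G) : π.mat (g * h) = π.mat g * π.mat h := by
  simp [mat]

theorem mat_inv (π : UnitaryIrrep G) (g : G) : π.mat g⁻¹ = (π.mat g)ᴴ := by
  simp [mat, ← Matrix.star_eq_conjTranspose]

theorem mat_inv_mul (π : UnitaryIrrep G) (g : G) : π.mat g⁻¹ * π.mat g = 1 := by
  rw [← mat_mul, inv_mul_cancel, mat_one]

theorem mat_inv_apply (π : UnitaryIrrep G) (g : G) (i j : Fin π.dim) :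
    π.mat g⁻¹ i j = starRingEnd ℂ (π.mat g j i) := by
  rw [mat_inv]; rfl

theorem continuous_mat (π : UnitaryIrrep G) : Continuous π.mat :=
  continuous_subtype_val.comp π.continuous_toHom

/-- The matrix coefficient `g ↦ π(g) i j`. -/
def coef (π : UnitaryIrrep G) (i j : Fin π.dim) : C(G, ℂ) where
  toFun g := π.mat g i j
  continuous_toFun := π.continuous_mat.matrix_elem i j

@[simp]
theorem coef_apply (π : UnitaryIrrep G) (i j : Fin π.dim) (g : G) : π.coef i j g = π.mat g i j :=
  rfl

theorem character_apply (π : UnitaryIrrep G) (g : G) : π.character g = (π.mat g).trace := rfl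

theorem character_eq_sum (π : UnitaryIrrep G) : π.character = ∑ i, π.coef i i := by
  ext g
  simp [character_apply, Matrix.trace]

theorem unitaryRep_apply (π : UnitaryIrrep G) (g : G) :
    unitaryRep π.toHom g = Matrix.toLin' (π.mat g) := rfl

/-- Irreducibility requires two distinct subrepresentations, which the zero space cannot have. This
permits division by the dimension. -/
instance dim_neZero (π : UnitaryIrrep G) : NeZero π.dim := ⟨fun h => by
  have := π.irreducible
  obtain ⟨a, b, hab⟩ := exists_pair_ne (Subrepresentation (unitaryRep π.toHom))
  refine hab (Subrepresentation.toSubmodule_injective ?_)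
  have : Subsingleton (Fin π.dim → ℂ) := by rw [h]; infer_instance
  exact Subsingleton.elim _ _⟩

theorem character_one (π : UnitaryIrrep G) : π.character 1 = π.dim := by
  simp [character_apply, mat_one]

/-- A matrix intertwining two representations, as an intertwining map. -/
noncomputable def intertwiner {π π' : UnitaryIrrep G} (M : Matrix (Fin π'.dim) (Fin π.dim) ℂ)
    (h : ∀ g, M * π.mat g = π'.mat g * M) :
    (unitaryRep π.toHom).IntertwiningMap (unitaryRep π'.toHom) where
  toLinearMap := Matrix.toLin' M
  isIntertwining' g := by
    rw [unitaryRep_apply, unitaryRep_apply, ← Matrix.toLin'_mul, ← Matrix.toLin'_mul, h]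

/-- **Schur's lemma**: a matrix commuting with an irreducible representation is scalar. -/
theorem exists_eq_smul_one {π : UnitaryIrrep G} {M : Matrix (Fin π.dim) (Fin π.dim) ℂ}
    (h : ∀ g, M * π.mat g = π.mat g * M) : ∃ c : ℂ, M = c • 1 := by
  have := π.irreducible
  obtain ⟨c, hc⟩ :=
    Representation.IsIrreducible.algebraMap_intertwiningMap_bijective_of_isAlgClosed.2
      (intertwiner M h)
  refine ⟨c, Matrix.toLin'.injective ?_⟩
  have h1 : Matrix.toLin' M = (algebraMap ℂ
      ((unitaryRep π.toHom).IntertwiningMap (unitaryRep π.toHom)) c).toLinearMap := by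
    rw [hc]; rfl
  rw [h1, map_smul, Matrix.toLin'_one, Algebra.algebraMap_eq_smul_one]
  rfl

/-- The scalar in Schur's lemma is determined by the trace. -/
theorem eq_trace_div_smul_one {π : UnitaryIrrep G} {M : Matrix (Fin π.dim) (Fin π.dim) ℂ}
    (h : ∀ g, M * π.mat g = π.mat g * M) : M = (M.trace / π.dim) • 1 := by
  obtain ⟨c, rfl⟩ := exists_eq_smul_one h
  have : (π.dim : ℂ) ≠ 0 := NeZero.ne _
  simp [Matrix.trace_smul, this]

/-- **Schur's lemma**: there is no nonzero intertwiner between inequivalent irreducible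
representations. -/
theorem eq_zero_of_not_equiv {π π' : UnitaryIrrep G} (hne : ¬ π ≈ π')
    {M : Matrix (Fin π'.dim) (Fin π.dim) ℂ} (h : ∀ g, M * π.mat g = π'.mat g * M) : M = 0 := by
  have := π.irreducible
  have := π'.irreducible
  rcases Representation.IsIrreducible.bijective_or_eq_zero (intertwiner M h) with hb | h0
  · exact absurd ⟨(intertwiner M h).ofBijective hb⟩ hne
  · refine Matrix.toLin'.injective ?_
    rw [map_zero]
    exact congrArg Representation.IntertwiningMap.toLinearMap h0

end UnitaryIrrep

end Schur

/-! ### Entrywise integration of matrix-valued functions. -/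

section MatrixIntegral

variable {X : Type*} [TopologicalSpace X] [CompactSpace X] [MeasurableSpace X]
  [OpensMeasurableSpace X] {ν : Measure X} [IsFiniteMeasure ν]

theorem integrable_of_continuous {f : X → ℂ} (hf : Continuous f) : Integrable f ν :=
  hf.integrable_of_hasCompactSupport (.of_compactSpace _)

variable {l m n : Type*} [Fintype m]

variable (ν) in
/-- The entrywise integral of a matrix-valued function. -/
noncomputable def matrixIntegral (F : X → Matrix l n ℂ) : Matrix l n ℂ :=
  Matrix.of fun i j => ∫ x, F x i j ∂ν

omit [TopologicalSpace X] [CompactSpace X] [OpensMeasurableSpace X] [IsFiniteMeasure ν] in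
theorem matrixIntegral_apply (F : X → Matrix l n ℂ) (i : l) (j : n) :
    matrixIntegral ν F i j = ∫ x, F x i j ∂ν := rfl

theorem matrixIntegral_mul {F : X → Matrix l m ℂ} (hF : Continuous F) (B : Matrix m n ℂ) :
    matrixIntegral ν F * B = matrixIntegral ν fun x => F x * B := by
  ext i k
  simp only [Matrix.mul_apply, matrixIntegral_apply, ← integral_mul_const]
  exact (integral_finsetSum _ fun j _ =>
    (integrable_of_continuous (hF.matrix_elem i j)).mul_const _).symm

theorem mul_matrixIntegral {F : X → Matrix m n ℂ} (hF : Continuous F) (B : Matrix l m ℂ) :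
    B * matrixIntegral ν F = matrixIntegral ν fun x => B * F x := by
  ext i k
  simp only [Matrix.mul_apply, matrixIntegral_apply, ← integral_const_mul]
  exact (integral_finsetSum _ fun j _ =>
    (integrable_of_continuous (hF.matrix_elem j k)).const_mul _).symm

theorem trace_matrixIntegral {F : X → Matrix m m ℂ} (hF : Continuous F) :
    (matrixIntegral ν F).trace = ∫ x, (F x).trace ∂ν :=
  (integral_finsetSum _ fun j _ => integrable_of_continuous (hF.matrix_elem j j)).symm

end MatrixIntegral

/-! ### Schur orthogonality relations. -/

section Orthogonality

variable {G : Type*} [Group G] [TopologicalSpace G] [IsTopologicalGroup G] [CompactSpace G]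
  [MeasurableSpace G] [BorelSpace G]

theorem inner_toL2 (f h : C(G, ℂ)) :
    inner ℂ (toL2 f) (toL2 h) = ∫ x, h x * starRingEnd ℂ (f x) ∂haarProb G :=
  ContinuousMap.inner_toLp (𝕜 := ℂ) (haarProb G) f h

theorem toL2_injective : Function.Injective (toL2 (G := G)) :=
  ContinuousMap.toLp_injective (haarProb G)

/-- Inversion exchanges left and right invariance, and `haarProb` has both, so its inverse is a Haar
probability measure; uniqueness finishes. -/
instance : (haarProb G).IsInvInvariant := ⟨by
  have : IsProbabilityMeasure (haarProb G).inv :=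
    isProbabilityMeasure_map (by fun_prop)
  have : (haarProb G).inv.IsHaarMeasure := 
    { toIsFiniteMeasureOnCompacts := inferInstance
      toIsMulLeftInvariant := inferInstance
      toIsOpenPosMeasure := inferInstance }
  exact isHaarMeasure_eq_of_isProbabilityMeasure _ _⟩

namespace UnitaryIrrep

open Matrix

/-- The average `∫ π(g) A π'(g)⁻¹ dg`. -/
noncomputable def average (π π' : UnitaryIrrep G) (A : Matrix (Fin π.dim) (Fin π'.dim) ℂ) :
    Matrix (Fin π.dim) (Fin π'.dim) ℂ :=
  matrixIntegral (haarProb G) fun g => π.mat g * A * π'.mat g⁻¹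

omit [CompactSpace G] [MeasurableSpace G] [BorelSpace G] in
theorem continuous_average_integrand (π π' : UnitaryIrrep G)
    (A : Matrix (Fin π.dim) (Fin π'.dim) ℂ) :
    Continuous fun g => π.mat g * A * π'.mat g⁻¹ := by
  have h := π.continuous_mat
  have h' := π'.continuous_mat
  fun_prop

/-- Left invariance of Haar measure: substitute `h * g` for `g` in the average. -/
theorem average_intertwines (π π' : UnitaryIrrep G) (A : Matrix (Fin π.dim) (Fin π'.dim) ℂ)
    (h : G) : average π π' A * π'.mat h = π.mat h * average π π' A := by
  rw [average, matrixIntegral_mul (continuous_average_integrand π π' A),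
    mul_matrixIntegral (continuous_average_integrand π π' A)]
  ext i k
  rw [matrixIntegral_apply, matrixIntegral_apply, ← integral_mul_left_eq_self _ h]
  congr 1 with g
  rw [_root_.mul_inv_rev, mat_mul, mat_mul]
  simp only [Matrix.mul_assoc, mat_inv_mul, Matrix.mul_one]

/-- A matrix unit isolates one product of coefficients, and unitarity turns the inverse into a
conjugate. Schur's lemma for averages thus becomes a statement about `L²` inner products. -/
theorem average_single (π π' : UnitaryIrrep G) (i j : Fin π.dim) (k l : Fin π'.dim) :
    average π π' (Matrix.single j l 1) i k =
      inner ℂ (toL2 (π'.coef k l)) (toL2 (π.coef i j)) := by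
  rw [inner_toL2]
  rw [average, matrixIntegral_apply]
  congr 1 with g
  rw [Matrix.mul_assoc, Matrix.mul_apply, Finset.sum_eq_single j]
  · simp [mat_inv_apply]
  · intro b _ hb
    simp [hb]
  · simp

/-- Matrix coefficients of inequivalent irreducible representations are orthogonal. -/
theorem inner_coef_of_not_equiv {π π' : UnitaryIrrep G} (hne : ¬ π' ≈ π) (i j : Fin π.dim)
    (k l : Fin π'.dim) : inner ℂ (toL2 (π'.coef k l)) (toL2 (π.coef i j)) = 0 := by
  rw [← average_single, eq_zero_of_not_equiv hne (average_intertwines π π' _)]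
  rfl

theorem trace_average (π : UnitaryIrrep G) (A : Matrix (Fin π.dim) (Fin π.dim) ℂ) :
    (average π π A).trace = A.trace := by
  rw [average, trace_matrixIntegral (continuous_average_integrand π π A)]
  simp [Matrix.trace_mul_cycle _ A, mat_inv_mul]

/-- Schur orthogonality within one irreducible representation. -/
theorem inner_coef_self (π : UnitaryIrrep G) (i j k l : Fin π.dim) :
    inner ℂ (toL2 (π.coef k l)) (toL2 (π.coef i j)) =
      if i = k ∧ j = l then (π.dim : ℂ)⁻¹ else 0 := by
  rw [← average_single, eq_trace_div_smul_one (average_intertwines π π _), trace_average]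
  by_cases h1 : i = k <;> by_cases h2 : j = l <;>
    simp [h1, h2, Matrix.trace_single_eq_same, Matrix.trace_single_eq_of_ne]

theorem inner_character_of_not_equiv {π π' : UnitaryIrrep G} (hne : ¬ π' ≈ π) :
    inner ℂ (toL2 π'.character) (toL2 π.character) = 0 := by
  simp [character_eq_sum, sum_inner, inner_sum, inner_coef_of_not_equiv hne]

theorem inner_character_self (π : UnitaryIrrep G) :
    inner ℂ (toL2 π.character) (toL2 π.character) = 1 := by
  have : (π.dim : ℂ) ≠ 0 := NeZero.ne _
  simp only [character_eq_sum, _root_.map_sum, sum_inner, inner_sum, inner_coef_self]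
  simp [this]

end UnitaryIrrep

/-- The characters of the irreducible representations are orthonormal. -/
theorem orthonormal_character :
    Orthonormal ℂ (fun π : UnitaryDual G => toL2 π.character) := by
  classical
  rw [orthonormal_iff_ite]
  rintro ⟨π⟩ ⟨π'⟩
  change inner ℂ (toL2 π.character) (toL2 π'.character) = _
  split_ifs with h
  · rw [← UnitaryIrrep.character_eq_of_equiv (Quotient.exact h), UnitaryIrrep.inner_character_self]
  · exact UnitaryIrrep.inner_character_of_not_equiv fun h' => h (Quotient.sound h')

end Orthogonality

/-! ### Continuous one-parameter multiplicative semigroups of reals. -/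

section ExpSemigroup

open Filter Topology

/-- A continuous additive function on the half-line is linear. -/
theorem eq_mul_of_continuous_additive {l : ℝ≥0 → ℝ} (hc : Continuous l)
    (hadd : ∀ s t, l (s + t) = l s + l t) (t : ℝ≥0) : l t = t * l 1 := by
  have h0 : l 0 = 0 := by simpa using hadd 0 0
  -- Extend `l` to the whole line through positive and negative parts, where continuous additive
  -- maps are known to be `ℝ`-linear.
  let L : ℝ →+ ℝ :=
    { toFun := fun x => l x.toNNReal - l (-x).toNNReal
      map_zero' := by simp
      map_add' := fun x y => by
        -- Additivity rearranged without subtraction, so that it makes sense in `ℝ≥0` and `hadd`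
        -- applies.
        have key : (x + y).toNNReal + (-x).toNNReal + (-y).toNNReal =
            (-(x + y)).toNNReal + x.toNNReal + y.toNNReal := by
          apply NNReal.coe_injective
          push_cast [Real.coe_toNNReal']
          have hp : ∀ z : ℝ, max z 0 = z + max (-z) 0 := fun z => by
            rcases le_total z 0 with h | h <;> simp [h]
          rw [hp (x + y), hp x, hp y]
          ring
        have h := congrArg l key
        simp only [hadd] at h
        linarith }
  have hL : Continuous L := by
    change Continuous fun x : ℝ => l x.toNNReal - l (-x).toNNReal
    fun_prop
  have hpos : ∀ x : ℝ≥0, L x = l x := fun x => by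
    change l (x : ℝ).toNNReal - l (-(x : ℝ)).toNNReal = l x
    rw [Real.toNNReal_coe, Real.toNNReal_of_nonpos (by simp : -(x : ℝ) ≤ 0), h0, sub_zero]
  have h := map_real_smul L hL (t : ℝ) ((1 : ℝ≥0) : ℝ)
  rw [hpos, smul_eq_mul, smul_eq_mul, NNReal.coe_one, mul_one, hpos] at h
  exact h

/-- A continuous multiplicative semigroup of real contractions is `exp (t a)` with `a ≤ 0`. -/
theorem exists_eq_exp_of_continuous_mul {φ : ℝ≥0 → ℝ} (hc : Continuous φ) (h0 : φ 0 = 1)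
    (hadd : ∀ s t, φ (s + t) = φ s * φ t) (hle : ∀ t, φ t ≤ 1) :
    ∃ a ≤ 0, ∀ t, φ t = Real.exp (t * a) := by
  have hhalf : ∀ t, φ t = φ (t / 2) * φ (t / 2) := fun t => by rw [← hadd, add_halves]
  have hpos : ∀ t, 0 < φ t := fun t => by
    -- Being a square, `φ t` is nonnegative. A zero would propagate to every `t / 2 ^ n`,
    -- contradicting `φ 0 = 1` and continuity at 0.
    refine lt_of_le_of_ne (by rw [hhalf]; exact mul_self_nonneg _) fun ht => ?_
    have hn : ∀ n : ℕ, φ (t / 2 ^ n) = 0 := fun n => by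
      induction n with
      | zero => simpa using ht.symm
      | succ n ih =>
        rw [hhalf] at ih
        rw [pow_succ, ← div_div]
        exact mul_self_eq_zero.mp ih
    have hlim : Tendsto (fun n : ℕ => t / 2 ^ n) atTop (𝓝 0) := by
      have h2 := (NNReal.tendsto_pow_atTop_nhds_zero_of_lt_one (r := (2⁻¹ : ℝ≥0))
        (inv_lt_one_of_one_lt₀ one_lt_two)).const_mul t
      simpa [div_eq_mul_inv] using h2
    have h1 := (hc.tendsto 0).comp hlim
    simp only [Function.comp_def, hn, h0] at h1
    exact zero_ne_one (tendsto_nhds_unique tendsto_const_nhds h1)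
  refine ⟨Real.log (φ 1), Real.log_nonpos (hpos 1).le (hle 1), fun t => ?_⟩
  rw [← eq_mul_of_continuous_additive (l := fun t => Real.log (φ t))
    (hc.log fun t => (hpos t).ne')
    (fun s t => by rw [hadd, Real.log_mul (hpos s).ne' (hpos t).ne']) t, Real.exp_log (hpos t)]

end ExpSemigroup

/-! ### Central measures acting on characters and on class functions. -/

section CentralMeasures

variable {G : Type*} [Group G] [TopologicalSpace G] [IsTopologicalGroup G]
  [MeasurableSpace G] [BorelSpace G]

theorem IsCentral.map_conj {ν : Measure G} (hν : IsCentral ν) (g : G) :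
    ν.map (fun x => g * x * g⁻¹) = ν := by
  have hm : Measurable fun x : G => g * x * g⁻¹ :=
    (by fun_prop : Continuous fun x : G => g * x * g⁻¹).measurable
  ext A hA
  rw [Measure.map_apply hm hA, ← hν g _ (hm hA), Set.image_preimage_eq]
  exact fun x => ⟨g⁻¹ * x * g, by group⟩

theorem IsCentral.integral_conj {ν : Measure G} (hν : IsCentral ν) (g : G) {f : G → ℂ}
    (hf : Continuous f) [CompactSpace G] [IsFiniteMeasure ν] :
    ∫ x, f (g * x * g⁻¹) ∂ν = ∫ x, f x ∂ν := by
  have hm : Continuous fun x : G => g * x * g⁻¹ := by fun_prop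
  conv_rhs => rw [← hν.map_conj g]
  refine (integral_map hm.measurable.aemeasurable ?_).symm
  rw [hν.map_conj g]
  exact (integrable_of_continuous hf).aestronglyMeasurable

theorem IsSymmetric.integral_inv {ν : Measure G} (hν : IsSymmetric ν) {f : G → ℂ}
    (hf : Continuous f) [CompactSpace G] [IsFiniteMeasure ν] :
    ∫ x, f x⁻¹ ∂ν = ∫ x, f x ∂ν := by
  have hm : Measurable fun x : G => x⁻¹ := continuous_inv.measurable
  have hmap : ν.map (fun x => x⁻¹) = ν := by
    ext A hA
    rw [Measure.map_apply hm hA, ← hν _ (hm hA), Set.image_preimage_eq]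
    exact inv_surjective
  conv_rhs => rw [← hmap]
  refine (integral_map hm.aemeasurable ?_).symm
  rw [hmap]
  exact (integrable_of_continuous hf).aestronglyMeasurable

variable [CompactSpace G]

/-- The scalar by which a central measure acts on an irreducible representation, in terms of the
character. -/
noncomputable def multiplier (ν : Measure G) (χ : C(G, ℂ)) : ℂ :=
  (∫ x, χ x ∂ν) / χ 1

namespace UnitaryIrrep

omit [IsTopologicalGroup G] [BorelSpace G] [CompactSpace G] in
theorem fourier_eq_matrixIntegral (ν : Measure G) (π : UnitaryIrrep G) :
    π.fourier ν = matrixIntegral ν π.mat := rfl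

variable {ν : Measure G} [IsFiniteMeasure ν]

/-- Conjugation invariance makes the Fourier transform an intertwiner, and its trace fixes the
scalar. Expressed through the character, the scalar depends only on the class of `π`. -/
theorem fourier_eq_smul_one (hν : IsCentral ν) (π : UnitaryIrrep G) :
    π.fourier ν = multiplier ν π.character • 1 := by
  have hcomm : ∀ g, π.fourier ν * π.mat g = π.mat g * π.fourier ν := fun g => by
    rw [fourier_eq_matrixIntegral, matrixIntegral_mul π.continuous_mat,
      mul_matrixIntegral π.continuous_mat]
    have hc : Continuous fun x => π.mat x * π.mat g := by
      have := π.continuous_mat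
      fun_prop
    ext i j
    rw [matrixIntegral_apply, matrixIntegral_apply,
      ← hν.integral_conj g (hc.matrix_elem i j)]
    congr 1 with x
    rw [mat_mul, mat_mul, Matrix.mul_assoc, mat_inv_mul, Matrix.mul_one]
  have htr : (π.fourier ν).trace = ∫ x, π.character x ∂ν := trace_matrixIntegral π.continuous_mat
  rw [eq_trace_div_smul_one hcomm, htr, multiplier, character_one]

theorem integral_character_mul (hν : IsCentral ν) (π : UnitaryIrrep G) (x : G) :
    ∫ y, π.character (x * y) ∂ν = multiplier ν π.character * π.character x := by
  have hc : Continuous fun y => π.mat x * π.mat y := by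
    have := π.continuous_mat
    fun_prop
  have h := mul_matrixIntegral (ν := ν) π.continuous_mat (π.mat x)
  rw [← fourier_eq_matrixIntegral, fourier_eq_smul_one hν] at h
  have h' := congrArg Matrix.trace h
  rw [trace_matrixIntegral hc, Matrix.mul_smul, Matrix.mul_one, Matrix.trace_smul] at h'
  simp only [character_apply, mat_mul]
  exact h'.symm

/-- By unitarity, inverting the argument conjugates the character, so symmetry of the measure makes
the scalar real. -/
theorem conj_multiplier (hν : IsSymmetric ν) (π : UnitaryIrrep G) :
    starRingEnd ℂ (multiplier ν π.character) = multiplier ν π.character := by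
  have h : ∀ x, π.character x⁻¹ = starRingEnd ℂ (π.character x) := fun x => by
    simp [character_apply, Matrix.trace, mat_inv_apply]
  rw [multiplier, map_div₀, character_one, Complex.conj_natCast, ← integral_conj]
  simp_rw [← h]
  rw [hν.integral_inv π.character.continuous]

end UnitaryIrrep

theorem huntC_character {ν : ProbabilityMeasure G} (hν : IsCentral (ν : Measure G))
    (π : UnitaryIrrep G) :
    huntC ν π.character = multiplier (ν : Measure G) π.character • π.character := by
  ext x
  exact π.integral_character_mul hν x

theorem hunt_character {ν : ProbabilityMeasure G} (hν : IsCentral (ν : Measure G))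
    (π : UnitaryIrrep G) :
    hunt ν (toL2 π.character) = multiplier (ν : Measure G) π.character • toL2 π.character := by
  rw [hunt_toL2, huntC_character hν, map_smul]

/-- The multiplier is the eigenvalue of a contraction at a unit vector. -/
theorem norm_multiplier_le_one {ν : ProbabilityMeasure G} (hν : IsCentral (ν : Measure G))
    (π : UnitaryIrrep G) : ‖multiplier (ν : Measure G) π.character‖ ≤ 1 := by
  have h1 : ‖toL2 π.character‖ = 1 :=
    (orthonormal_character (G := G)).1 (UnitaryDual.mk π)
  have h := (hunt ν).le_of_opNorm_le (norm_hunt_le ν) (toL2 π.character)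
  rwa [hunt_character hν, norm_smul, h1, mul_one, one_mul] at h

omit [IsTopologicalGroup G] in
theorem continuous_multiplier {μ : ℝ≥0 → ProbabilityMeasure G} (hμ : Continuous μ)
    (χ : C(G, ℂ)) : Continuous fun t => multiplier (μ t : Measure G) χ := by
  -- Weak convergence is tested on real functions, so real and imaginary parts are treated
  -- separately.
  have hreal : ∀ f : C(G, ℝ), Continuous fun t => ∫ x, f x ∂(μ t : Measure G) := fun f =>
    continuous_iff_continuousAt.mpr fun t =>
      (ProbabilityMeasure.tendsto_iff_forall_integral_tendsto.mp (hμ.tendsto t))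
        (BoundedContinuousFunction.mkOfCompact f)
  have hsum : ∀ t, ∫ x, χ x ∂(μ t : Measure G) =
      ((∫ x, (χ x).re ∂(μ t : Measure G) : ℝ) : ℂ) +
        ((∫ x, (χ x).im ∂(μ t : Measure G) : ℝ) : ℂ) * Complex.I := fun t =>
    (integral_re_add_im (integrable_of_continuous χ.continuous)).symm
  unfold multiplier
  simp_rw [hsum]
  have h1 := hreal ⟨fun x => (χ x).re, by fun_prop⟩
  have h2 := hreal ⟨fun x => (χ x).im, by fun_prop⟩
  simp only [ContinuousMap.coe_mk] at h1 h2
  fun_prop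

/-- The multipliers of a central symmetric convolution semigroup are `exp (t a)` with `a ≤ 0`. -/
theorem exists_multiplier_eq_exp {μ : ℝ≥0 → ProbabilityMeasure G} (hμ : IsConvolutionSemigroup μ)
    (hcentral : ∀ t, IsCentral (μ t : Measure G)) (hsymm : ∀ t, IsSymmetric (μ t : Measure G))
    (π : UnitaryIrrep G) :
    ∃ a : ℝ, a ≤ 0 ∧ ∀ t, multiplier (μ t : Measure G) π.character = Complex.exp (t * a) := by
  set c : ℝ≥0 → ℂ := fun t => multiplier (μ t : Measure G) π.character with hcdef
  have hre : ∀ t, c t = ((c t).re : ℂ) := fun t =>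
    (Complex.conj_eq_iff_re.mp (π.conj_multiplier (hsymm t))).symm
  have hadd : ∀ s t, c (s + t) = c s * c t := fun s t => by
    simp only [hcdef]
    rw [multiplier, hμ.add]
    simp_rw [π.integral_character_mul (hcentral t)]
    rw [integral_const_mul, multiplier, multiplier]
    ring
  have hdim : (π.dim : ℂ) ≠ 0 := NeZero.ne _
  have hzero : c 0 = 1 := by
    simp only [hcdef]
    rw [multiplier, hμ.zero, integral_dirac' _ _ π.character.continuous.stronglyMeasurable,
      UnitaryIrrep.character_one, div_self hdim]
  obtain ⟨a, ha, h⟩ := exists_eq_exp_of_continuous_mul (φ := fun t => (c t).re)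
    (Complex.continuous_re.comp (continuous_multiplier hμ.continuous _)) (by simp [hzero])
    (fun s t => by rw [hadd, hre s, hre t]; simp)
    (fun t => (Complex.re_le_norm _).trans (norm_multiplier_le_one (hcentral t) π))
  refine ⟨a, ha, fun t => ?_⟩
  change c t = _
  rw [hre, h]
  push_cast
  rfl

/-- Conjugation `f ↦ f (g · g⁻¹)` on `L²(G)`. -/
noncomputable def conjL2 (g : G) : L2 G →ₗᵢ[ℂ] L2 G :=
  Lp.compMeasurePreservingₗᵢ ℂ _ (measurePreserving_conj G g)

/-- Conjugation `f ↦ f (g · g⁻¹)` on `C(G)`. -/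
noncomputable def conjC (g : G) (f : C(G, ℂ)) : C(G, ℂ) := ⟨fun x => f (g * x * g⁻¹), by fun_prop⟩

theorem conjL2_toL2 (g : G) (f : C(G, ℂ)) : conjL2 g (toL2 f) = toL2 (conjC g f) := rfl

theorem mem_L2c_iff {f : L2 G} : f ∈ L2c G ↔ ∀ g, conjL2 g f = f := by
  refine forall_congr' fun g => ?_
  rw [Lp.ext_iff]
  have h : conjL2 g f =ᵐ[haarProb G] fun x => f (g * x * g⁻¹) :=
    Lp.coeFn_compMeasurePreserving f (measurePreserving_conj G g)
  exact ⟨fun h' => h.trans h', fun h' => h.symm.trans h'⟩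

theorem isClosed_L2c : IsClosed (L2c G : Set (L2 G)) := by
  have : (L2c G : Set (L2 G)) = ⋂ g : G, {f | conjL2 g f = f} := by
    ext f
    simp only [SetLike.mem_coe, mem_L2c_iff, Set.mem_iInter, Set.mem_ofPred_eq]
  rw [this]
  exact isClosed_iInter fun g => isClosed_eq (conjL2 g).continuous continuous_id

/-- On continuous functions this is the substitution `y ↦ g * y * g⁻¹`, which centrality allows;
density does the rest. -/
theorem hunt_conjL2 {ν : ProbabilityMeasure G} (hν : IsCentral (ν : Measure G)) (g : G)
    (f : L2 G) : hunt ν (conjL2 g f) = conjL2 g (hunt ν f) := by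
  refine denseRange_toL2.induction_on f
    (isClosed_eq ((hunt ν).continuous.comp (conjL2 g).continuous)
      ((conjL2 g).continuous.comp (hunt ν).continuous)) fun f => ?_
  rw [conjL2_toL2, hunt_toL2, hunt_toL2, conjL2_toL2]
  congr 1
  ext x
  change ∫ y, f (g * (x * y) * g⁻¹) ∂(ν : Measure G) = ∫ y, f (g * x * g⁻¹ * y) ∂(ν : Measure G)
  rw [← hν.integral_conj g (f := fun y => f (g * x * g⁻¹ * y)) (by fun_prop)]
  congr 1 with y
  congr 1
  group

theorem hunt_mem_L2c {ν : ProbabilityMeasure G} (hν : IsCentral (ν : Measure G)) {f : L2 G}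
    (hf : f ∈ L2c G) : hunt ν f ∈ L2c G := by
  rw [mem_L2c_iff] at hf ⊢
  intro g
  rw [← hunt_conjL2 hν, hf]

theorem character_mem_L2c (π : UnitaryIrrep G) : toL2 π.character ∈ L2c G := by
  rw [mem_L2c_iff]
  intro g
  rw [conjL2_toL2]
  congr 1
  ext x
  change (π.mat (g * x * g⁻¹)).trace = (π.mat x).trace
  rw [π.mat_mul, π.mat_mul, Matrix.trace_mul_cycle, π.mat_inv_mul, Matrix.one_mul]

end CentralMeasures

/-! ### The Peter–Weyl theorem via compact convolution operators. -/

section PeterWeyl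

open Filter Topology Matrix

variable {G : Type*} [Group G] [TopologicalSpace G] [IsTopologicalGroup G] [CompactSpace G]
  [MeasurableSpace G] [BorelSpace G]

/-- Right translation `f ↦ f (· g)` on `L²(G)`. -/
noncomputable def transL2 (g : G) : L2 G →ₗᵢ[ℂ] L2 G :=
  Lp.compMeasurePreservingₗᵢ ℂ _ (measurePreserving_mul_right (haarProb G) g)

/-- Right translation `f ↦ f (· g)` on `C(G)`. -/
noncomputable def transC (g : G) (f : C(G, ℂ)) : C(G, ℂ) := ⟨fun x => f (x * g), by fun_prop⟩

theorem transL2_toL2 (g : G) (f : C(G, ℂ)) : transL2 g (toL2 f) = toL2 (transC g f) := rfl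

omit [CompactSpace G] [MeasurableSpace G] [BorelSpace G] in
@[simp]
theorem transC_apply (g x : G) (f : C(G, ℂ)) : transC g f x = f (x * g) := rfl

omit [CompactSpace G] [MeasurableSpace G] [BorelSpace G] in
theorem continuous_transC (f : C(G, ℂ)) : Continuous fun g => transC g f := by
  let F : C(G × G, ℂ) := ⟨fun p => f (p.2 * p.1), by fun_prop⟩
  exact F.curry.continuous

theorem transL2_mul (g h : G) (f : L2 G) : transL2 g (transL2 h f) = transL2 (g * h) f := by
  refine denseRange_toL2.induction_on f
    (isClosed_eq ((transL2 g).continuous.comp (transL2 h).continuous)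
      (transL2 (g * h)).continuous) fun f => ?_
  rw [transL2_toL2, transL2_toL2, transL2_toL2]
  congr 1
  ext x
  simp [mul_assoc]

theorem transL2_one (f : L2 G) : transL2 1 f = f := by
  refine denseRange_toL2.induction_on f
    (isClosed_eq (transL2 1).continuous continuous_id) fun f => ?_
  rw [transL2_toL2]
  congr 1
  ext x
  simp

theorem inner_transL2 (g : G) (f h : L2 G) :
    inner ℂ (transL2 g f) (transL2 g h) = inner ℂ f h :=
  (transL2 g).inner_map_map f h

theorem inner_transL2_left (g : G) (f h : L2 G) :
    inner ℂ (transL2 g⁻¹ f) h = inner ℂ f (transL2 g h) := by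
  rw [← inner_transL2 g, transL2_mul, mul_inv_cancel, transL2_one]

/-- The convolution operator `f ↦ (x ↦ ⟪q, f (· x)⟫)` from `L²(G)` to `C(G)`. -/
noncomputable def convC (q : C(G, ℂ)) : L2 G →ₗ[ℂ] C(G, ℂ) where
  toFun f := ⟨fun x => inner ℂ (toL2 (transC x⁻¹ q)) f,
    ((toL2.continuous.comp ((continuous_transC q).comp continuous_inv)).inner continuous_const)⟩
  map_add' f h := by ext x; exact inner_add_right (𝕜 := ℂ) (toL2 (transC x⁻¹ q)) f h
  map_smul' c f := by ext x; exact inner_smul_right (𝕜 := ℂ) (toL2 (transC x⁻¹ q)) f c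

theorem convC_apply (q : C(G, ℂ)) (f : L2 G) (x : G) :
    convC q f x = inner ℂ (toL2 q) (transL2 x f) := by
  rw [← inner_transL2_left]
  rfl

/-- The modulus of continuity depends on `f` only through its norm: this is the equicontinuity
needed for Arzelà–Ascoli. -/
theorem norm_convC_apply_sub_le (q : C(G, ℂ)) (f : L2 G) (x y : G) :
    ‖convC q f x - convC q f y‖ ≤ ‖toL2 (transC x⁻¹ q) - toL2 (transC y⁻¹ q)‖ * ‖f‖ := by
  change ‖inner ℂ _ f - inner ℂ _ f‖ ≤ _
  rw [← inner_sub_left]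
  exact norm_inner_le_norm _ _

theorem norm_convC_le (q : C(G, ℂ)) (f : L2 G) : ‖convC q f‖ ≤ ‖toL2 q‖ * ‖f‖ := by
  refine (ContinuousMap.norm_le _ (by positivity)).mpr fun x => ?_
  rw [convC_apply]
  refine (norm_inner_le_norm _ _).trans_eq ?_
  rw [(transL2 x).norm_map]

/-- The convolution operator on `L²(G)`. -/
noncomputable def convL2 (q : C(G, ℂ)) : L2 G →L[ℂ] L2 G :=
  toL2.comp ((convC q).mkContinuous ‖toL2 q‖ (norm_convC_le q))

theorem convL2_apply (q : C(G, ℂ)) (f : L2 G) : convL2 q f = toL2 (convC q f) := rfl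

theorem convC_transL2 (q : C(G, ℂ)) (g : G) (f : L2 G) :
    convC q (transL2 g f) = transC g (convC q f) := by
  ext x
  rw [transC_apply, convC_apply, convC_apply, transL2_mul]

theorem convL2_transL2 (q : C(G, ℂ)) (g : G) (f : L2 G) :
    convL2 q (transL2 g f) = transL2 g (convL2 q f) := by
  rw [convL2_apply, convL2_apply, convC_transL2, transL2_toL2]

/-- Already as a map into `C(G)` the operator is compact: the image of the unit ball is bounded and
equicontinuous. -/
theorem isCompactOperator_convL2 (q : C(G, ℂ)) : IsCompactOperator (convL2 q) := by
  refine IsCompactOperator.clm_comp (f := (convC q).mkContinuous ‖toL2 q‖ (norm_convC_le q)) ?_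
    (toL2 (G := G))
  refine (isCompactOperator_iff_image_closedBall_subset_compact
    ((convC q).mkContinuous ‖toL2 q‖ (norm_convC_le q)).toLinearMap one_pos).mpr ?_
  let e := ContinuousMap.isometryEquivBoundedOfCompact G ℂ
  set S : Set C(G, ℂ) := convC q '' Metric.closedBall 0 1 with hS
  refine ⟨e.symm '' closure (e '' S), IsCompact.image ?_ e.symm.continuous, fun φ hφ =>
    ⟨e φ, subset_closure ⟨φ, hφ, rfl⟩, e.symm_apply_apply φ⟩⟩
  refine BoundedContinuousFunction.arzela_ascoli (Metric.closedBall 0 ‖toL2 q‖)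
    (isCompact_closedBall _ _) _ ?_ ?_
  · rintro _ x ⟨_, ⟨f, hf, rfl⟩, rfl⟩
    rw [mem_closedBall_zero_iff] at hf ⊢
    refine ((convC q f).norm_coe_le_norm x).trans ((norm_convC_le q f).trans ?_)
    exact mul_le_of_le_one_right (norm_nonneg _) hf
  · intro x₀
    rw [Metric.equicontinuousAt_iff_right]
    intro ε hε
    have hc : Continuous fun x => toL2 (transC x⁻¹ q) :=
      toL2.continuous.comp ((continuous_transC q).comp continuous_inv)
    filter_upwards [Metric.tendsto_nhds.mp (hc.tendsto x₀) ε hε] with x hx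
    rintro ⟨_, ⟨_, ⟨f, hf, rfl⟩, rfl⟩⟩
    rw [mem_closedBall_zero_iff] at hf
    rw [dist_comm, dist_eq_norm]
    rw [dist_eq_norm] at hx
    exact ((norm_convC_apply_sub_le q f x x₀).trans
      (mul_le_of_le_one_right (norm_nonneg _) hf)).trans_lt hx

/-- The integral kernel is the conjugate of `q (z * x⁻¹)`, which is Hermitian in `x` and `z` exactly
under `hq`. In the computation, Fubini is followed by inverting `y` and translating `x` by `y`. -/
theorem isSymmetric_convL2 {q : C(G, ℂ)} (hq : ∀ x, q x⁻¹ = starRingEnd ℂ (q x)) :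
    (convL2 q).IsSymmetric := by
  have hcont : ∀ f h : C(G, ℂ), inner ℂ (convL2 q (toL2 f)) (toL2 h) =
      inner ℂ (toL2 f) (convL2 q (toL2 h)) := fun f h => by
    have hconv : ∀ (f : C(G, ℂ)) x, convC q (toL2 f) x =
        ∫ y, f (y * x) * starRingEnd ℂ (q y) ∂haarProb G := fun f x => by
      rw [convC_apply, transL2_toL2, inner_toL2]
      rfl
    rw [convL2_apply, convL2_apply, inner_toL2, inner_toL2]
    simp_rw [hconv, ← integral_conj, ← integral_const_mul, ← integral_mul_const]
    rw [integral_integral_swap_of_hasCompactSupport (f := fun x y =>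
        h x * starRingEnd ℂ (f (y * x) * starRingEnd ℂ (q y))) (by fun_prop)
        (.of_compactSpace _),
      integral_integral_swap_of_hasCompactSupport (f := fun x y =>
        h (y * x) * starRingEnd ℂ (q y) * starRingEnd ℂ (f x)) (by fun_prop)
        (.of_compactSpace _), ← integral_inv_eq_self _ (haarProb G)]
    congr 1 with y
    rw [← integral_mul_left_eq_self _ y]
    congr 1 with x
    rw [inv_mul_cancel_left, hq]
    simp
    ring
  intro f h
  refine denseRange_toL2.induction_on₂ (p := fun f h =>
    inner ℂ (convL2 q f) h = inner ℂ f (convL2 q h)) ?_ hcont f h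
  exact isClosed_eq (by fun_prop) (by fun_prop)

variable (G) in
/-- The span in `L²(G)` of the matrix coefficients of the irreducible representations. -/
noncomputable def coefSpan : Submodule ℂ (L2 G) :=
  Submodule.span ℂ {f | ∃ (π : UnitaryIrrep G) (i j : Fin π.dim), f = toL2 (π.coef i j)}

theorem toL2_coef_mem_coefSpan (π : UnitaryIrrep G) (i j : Fin π.dim) :
    toL2 (π.coef i j) ∈ coefSpan G :=
  Submodule.subset_span ⟨π, i, j, rfl⟩

/-- An irreducible finite-dimensional translation invariant space of continuous functions is
spanned by matrix coefficients. -/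
theorem le_coefSpan_of_irreducible {E : Submodule ℂ (L2 G)} [FiniteDimensional ℂ E]
    (hE : ∀ f ∈ E, ∃ φ : C(G, ℂ), toL2 φ = f) (hinv : ∀ g, ∀ f ∈ E, transL2 g f ∈ E)
    (hbot : E ≠ ⊥)
    (hirr : ∀ V ≤ E, (∀ g, ∀ f ∈ V, transL2 g f ∈ V) → V = ⊥ ∨ V = E) : E ≤ coefSpan G := by
  let b := stdOrthonormalBasis ℂ E
  let d := Module.finrank ℂ E
  let e : Fin d → L2 G := fun j => b j
  have heE : ∀ j, e j ∈ E := fun j => (b j).2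
  -- Continuous representatives make pointwise evaluation legitimate, in particular at the identity.
  choose φ hφ using fun j => hE (e j) (heE j)
  have hexp : ∀ f ∈ E, f = ∑ i, inner ℂ (e i) f • e i := fun f hf => by
    have h := congrArg E.subtype (b.sum_repr' ⟨f, hf⟩)
    rw [_root_.map_sum] at h
    exact h.symm
  let A : G → Matrix (Fin d) (Fin d) ℂ :=
    fun g => Matrix.of fun i j => inner ℂ (e i) (transL2 g (e j))
  have htrans : ∀ g j, transL2 g (e j) = ∑ i, A g i j • e i := fun g j =>
    hexp _ (hinv g _ (heE j))
  have hφmul : ∀ g j x, φ j (x * g) = ∑ i, A g i j * φ i x := fun g j x => by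
    have h : transC g (φ j) = ∑ i, A g i j • φ i := by
      apply toL2_injective
      rw [← transL2_toL2, hφ, htrans, _root_.map_sum]
      simp_rw [map_smul, hφ]
    have h' := DFunLike.congr_fun h x
    simpa using h'
  have hAone : A 1 = 1 := by
    ext i j
    have h := orthonormal_iff_ite.mp b.orthonormal i j
    change inner ℂ (e i) (transL2 1 (e j)) = _
    rw [transL2_one, Matrix.one_apply]
    exact h
  have hAmul : ∀ g h, A (g * h) = A g * A h := fun g h => by
    ext i k
    change inner ℂ (e i) (transL2 (g * h) (e k)) = _
    rw [← transL2_mul, htrans h k, _root_.map_sum, inner_sum, Matrix.mul_apply]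
    refine Finset.sum_congr rfl fun j _ => ?_
    rw [map_smul, inner_smul_right, mul_comm]
    rfl
  -- Unitarity of `A` comes from translations being isometric and the basis orthonormal.
  have hAinv : ∀ g, A g⁻¹ = star (A g) := fun g => by
    ext i j
    change inner ℂ (e i) (transL2 g⁻¹ (e j)) = starRingEnd ℂ (inner ℂ (e j) (transL2 g (e i)))
    rw [inner_conj_symm, ← inner_transL2_left, inv_inv]
  let ρ : G →* Matrix.unitaryGroup (Fin d) ℂ :=
    { toFun := fun g => ⟨A g, by
        rw [Matrix.mem_unitaryGroup_iff', ← hAinv, ← hAmul, inv_mul_cancel, hAone]⟩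
      map_one' := Subtype.ext hAone
      map_mul' := fun g h => Subtype.ext (hAmul g h) }
  have hρ : Continuous ρ := by
    refine Continuous.subtype_mk (continuous_matrix fun i j => ?_) _
    change Continuous fun g => inner ℂ (e i) (transL2 g (e j))
    rw [← hφ j]
    exact continuous_const.inner (toL2.continuous.comp (continuous_transC (φ j)))
  -- `Φ` identifies the matrix representation with translation on `E`, carrying irreducibility over
  -- from `hirr`.
  let Φ : (Fin d → ℂ) →ₗ[ℂ] L2 G := E.subtype ∘ₗ b.toBasis.equivFun.symm.toLinearMap
  have hΦinj : Function.Injective Φ :=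
    E.injective_subtype.comp b.toBasis.equivFun.symm.injective
  have hΦrange : LinearMap.range Φ = E := by
    rw [LinearMap.range_comp_of_range_eq_top _ (LinearEquiv.range _), Submodule.range_subtype]
  have hΦ : ∀ v, Φ v = ∑ i, v i • e i := fun v => by
    change E.subtype (b.toBasis.equivFun.symm v) = _
    rw [Module.Basis.equivFun_symm_apply, _root_.map_sum]
    simp [e]
    rfl
  have hΦtrans : ∀ g v, Φ (unitaryRep ρ g v) = transL2 g (Φ v) := fun g v => by
    have h : unitaryRep ρ g v = A g *ᵥ v := rfl
    rw [h, hΦ, hΦ, _root_.map_sum]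
    simp_rw [map_smul, htrans, Finset.smul_sum, Matrix.mulVec, dotProduct, Finset.sum_smul]
    rw [Finset.sum_comm]
    simp_rw [smul_smul, mul_comm]
  have hsimple : (unitaryRep ρ).IsIrreducible :=
    { exists_pair_ne := by
        refine ⟨⊥, ⊤, fun h => hbot ?_⟩
        have h' : (⊥ : Submodule ℂ (Fin d → ℂ)) = ⊤ := congrArg Subrepresentation.toSubmodule h
        rw [← hΦrange, LinearMap.range_eq_map, ← h', Submodule.map_bot]
      eq_bot_or_eq_top := fun W => by
        rcases hirr (W.toSubmodule.map Φ) (hΦrange ▸ LinearMap.map_le_range) (by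
          rintro g _ ⟨v, hv, rfl⟩
          exact ⟨_, W.apply_mem_toSubmodule g hv, hΦtrans g v⟩) with h | h
        · left
          refine Subrepresentation.toSubmodule_injective ?_
          exact Submodule.map_injective_of_injective hΦinj (h.trans (Submodule.map_bot _).symm)
        · right
          refine Subrepresentation.toSubmodule_injective ?_
          rw [← hΦrange, LinearMap.range_eq_map] at h
          exact Submodule.map_injective_of_injective hΦinj h }
  let π : UnitaryIrrep G := ⟨d, ρ, hρ, hsimple⟩
  have hmem : ∀ j, e j ∈ coefSpan G := fun j => by
    -- Evaluate the transformation law `hφmul` at `x = 1`.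
    have h : φ j = ∑ i, φ i 1 • π.coef i j := by
      ext g
      have h := hφmul g j 1
      rw [one_mul] at h
      rw [h, ContinuousMap.sum_apply]
      refine Finset.sum_congr rfl fun i _ => ?_
      rw [mul_comm]
      rfl
    rw [← hφ j, h, _root_.map_sum]
    refine Submodule.sum_mem _ fun i _ => ?_
    rw [map_smul]
    exact Submodule.smul_mem _ _ (toL2_coef_mem_coefSpan π i j)
  intro f hf
  rw [hexp f hf]
  exact Submodule.sum_mem _ fun i _ => Submodule.smul_mem _ _ (hmem i)

/-- Complete reducibility by induction on dimension: translations are unitary, so the orthogonal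
complement of an invariant subspace is invariant, and a reducible `E` splits into two smaller
pieces. -/
theorem le_coefSpan_of_finrank (n : ℕ) : ∀ {E : Submodule ℂ (L2 G)} [FiniteDimensional ℂ E],
    (∀ f ∈ E, ∃ φ : C(G, ℂ), toL2 φ = f) → (∀ g, ∀ f ∈ E, transL2 g f ∈ E) →
    Module.finrank ℂ E = n → E ≤ coefSpan G := by
  induction n using Nat.strong_induction_on with
  | _ n ih =>
  intro E _ hE hinv hn
  by_cases hbot : E = ⊥
  · simp [hbot]
  by_cases hirr : ∀ V ≤ E, (∀ g, ∀ f ∈ V, transL2 g f ∈ V) → V = ⊥ ∨ V = E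
  · exact le_coefSpan_of_irreducible hE hinv hbot hirr
  push Not at hirr
  obtain ⟨V, hVE, hV, hVbot, hVne⟩ := hirr
  have : FiniteDimensional ℂ V := Submodule.finiteDimensional_of_le hVE
  have : FiniteDimensional ℂ (Vᗮ ⊓ E : Submodule ℂ (L2 G)) :=
    Submodule.finiteDimensional_of_le inf_le_right
  have hsum : V ⊔ Vᗮ ⊓ E = E := Submodule.sup_orthogonal_inf_of_hasOrthogonalProjection hVE
  have hlt : Vᗮ ⊓ E < E := by
    refine lt_of_le_of_ne inf_le_right fun h => hVbot ?_
    have : V ≤ Vᗮ := hVE.trans (inf_eq_right.mp h)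
    rw [← le_bot_iff, ← V.inf_orthogonal_eq_bot]
    exact le_inf le_rfl this
  rw [← hsum]
  refine sup_le ?_ ?_
  · exact ih _ (hn ▸ Submodule.finrank_lt_finrank_of_lt (lt_of_le_of_ne hVE hVne))
      (fun f hf => hE f (hVE hf)) hV rfl
  · refine ih _ (hn ▸ Submodule.finrank_lt_finrank_of_lt hlt)
      (fun f hf => hE f hf.2) (fun g f hf => ⟨?_, hinv g f hf.2⟩) rfl
    refine (Submodule.mem_orthogonal _ _).mpr fun v hv => ?_
    rw [← inner_transL2_left]
    exact (Submodule.mem_orthogonal _ _).mp hf.1 _ (hV _ v hv)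

/-- The eigenspaces of a convolution operator for nonzero eigenvalues consist of matrix
coefficients. -/
theorem eigenspace_le_coefSpan (q : C(G, ℂ)) {c : ℂ} (hc : c ≠ 0) :
    Module.End.eigenspace (convL2 q : Module.End ℂ (L2 G)) c ≤ coefSpan G := by
  have := ContinuousLinearMap.finite_dimensional_eigenspace (isCompactOperator_convL2 q) c hc
  refine le_coefSpan_of_finrank _ (fun f hf => ?_) (fun g f hf => ?_) rfl
  · rw [Module.End.mem_eigenspace_iff] at hf
    refine ⟨c⁻¹ • convC q f, ?_⟩
    rw [map_smul, ← convL2_apply]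
    exact (congrArg (c⁻¹ • ·) hf).trans (inv_smul_smul₀ hc f)
  · rw [Module.End.mem_eigenspace_iff] at hf ⊢
    have h := convL2_transL2 q g f
    exact h.trans ((congrArg (transL2 g) hf).trans (map_smul _ _ _))

/-- By self-adjointness the image of `f` is orthogonal to the kernel and, since `f` is orthogonal to
`coefSpan G`, to every other eigenspace. The spectral theorem leaves only zero. -/
theorem convL2_eq_zero_of_mem_orthogonal {q : C(G, ℂ)}
    (hq : ∀ x, q x⁻¹ = starRingEnd ℂ (q x)) {f : L2 G} (hf : f ∈ (coefSpan G)ᗮ) :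
    convL2 q f = 0 := by
  have hsymm := isSymmetric_convL2 hq
  have hbot := ContinuousLinearMap.orthogonalComplement_iSup_eigenspaces_eq_bot
    (isCompactOperator_convL2 q) hsymm
  rw [← Submodule.mem_bot ℂ, ← hbot, ← Submodule.iInf_orthogonal, Submodule.mem_iInf]
  intro c
  rw [Submodule.mem_orthogonal]
  intro e he
  have he' : convL2 q e = c • e := Module.End.mem_eigenspace_iff.mp he
  have h : inner ℂ e (convL2 q f) = inner ℂ (convL2 q e) f := (hsymm e f).symm
  rw [h, he', inner_smul_left]
  by_cases hc : c = 0
  · simp [hc]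
  · rw [(Submodule.mem_orthogonal _ _).mp hf e (eigenspace_le_coefSpan q hc he), mul_zero]

theorem inner_toL2_eq_zero_of_symm {q : C(G, ℂ)}
    (hq : ∀ x, q x⁻¹ = starRingEnd ℂ (q x)) {f : L2 G} (hf : f ∈ (coefSpan G)ᗮ) :
    inner ℂ (toL2 q) f = 0 := by
  have h := convL2_eq_zero_of_mem_orthogonal hq hf
  rw [convL2_apply, ← map_zero toL2] at h
  -- The convolution is a continuous function, so it vanishes everywhere; its value at the identity
  -- is the inner product sought.
  have h1 := DFunLike.congr_fun (toL2_injective h) 1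
  rwa [convC_apply, transL2_one] at h1

/-- **Peter–Weyl**: the matrix coefficients of irreducible representations are total in
`L²(G)`. -/
theorem coefSpan_orthogonal : (coefSpan G)ᗮ = ⊥ := by
  rw [eq_bot_iff]
  intro f hf
  have hq : ∀ q : C(G, ℂ), inner ℂ (toL2 q) f = 0 := fun q => by
    -- Split `q` into "real" and "imaginary" parts for the involution `q ↦ conj (q x⁻¹)`; both
    -- satisfy the Hermitian condition.
    let q₁ : C(G, ℂ) := ⟨fun x => (q x + starRingEnd ℂ (q x⁻¹)) / 2, by fun_prop⟩
    let q₂ : C(G, ℂ) := ⟨fun x => (q x - starRingEnd ℂ (q x⁻¹)) / (2 * Complex.I), by fun_prop⟩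
    have hsum : q = q₁ + Complex.I • q₂ := by
      ext x
      simp only [q₁, q₂, ContinuousMap.add_apply, ContinuousMap.smul_apply, ContinuousMap.coe_mk,
        smul_eq_mul]
      field_simp
      ring
    have h1 : inner ℂ (toL2 q₁) f = 0 := inner_toL2_eq_zero_of_symm (fun x => by
      simp [q₁, add_comm, Complex.conj_ofNat]) hf
    have h2 : inner ℂ (toL2 q₂) f = 0 := inner_toL2_eq_zero_of_symm (fun x => by
      simp only [q₂, ContinuousMap.coe_mk, inv_inv, map_div₀, map_sub, map_mul, Complex.conj_conj,
        Complex.conj_I, map_ofNat]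
      field_simp
      ring) hf
    rw [hsum, map_add, map_smul, inner_add_left, inner_smul_left, h1, h2]
    simp
  have h0 : ∀ h : L2 G, inner ℂ h f = 0 := fun h =>
    denseRange_toL2.induction_on h (isClosed_eq (by fun_prop) continuous_const) hq
  exact (Submodule.mem_bot ℂ).mpr (inner_self_eq_zero.mp (h0 f))

end PeterWeyl

/-! ### Completeness of the characters among class functions. -/

section Completeness

variable {G : Type*} [Group G] [TopologicalSpace G] [IsTopologicalGroup G] [CompactSpace G]
  [MeasurableSpace G] [BorelSpace G]

/-- A class function orthogonal to the character of `π` is orthogonal to all matrix coefficients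
of `π`. -/
theorem inner_coef_eq_zero_of_inner_character {f : L2 G} (hf : f ∈ L2c G) (π : UnitaryIrrep G)
    (h : inner ℂ f (toL2 π.character) = 0) (i j : Fin π.dim) :
    inner ℂ f (toL2 (π.coef i j)) = 0 := by
  let H : Matrix (Fin π.dim) (Fin π.dim) ℂ := Matrix.of fun i j => inner ℂ f (toL2 (π.coef i j))
  have hconj : ∀ g u, inner ℂ f (toL2 (conjC g u)) = inner ℂ f (toL2 u) := fun g u => by
    rw [← conjL2_toL2]
    nth_rewrite 1 [← mem_L2c_iff.mp hf g]
    exact (conjL2 g).inner_map_map _ _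
  have hcomm : ∀ g, H * π.mat g = π.mat g * H := fun g => by
    ext i j
    have h1 : (H * π.mat g) i j = inner ℂ f (toL2 (∑ k, π.mat g k j • π.coef i k)) := by
      rw [_root_.map_sum, inner_sum, Matrix.mul_apply]
      refine Finset.sum_congr rfl fun k _ => ?_
      rw [map_smul, inner_smul_right, mul_comm]
      rfl
    have h2 : (π.mat g * H) i j = inner ℂ f (toL2 (∑ k, π.mat g i k • π.coef k j)) := by
      rw [_root_.map_sum, inner_sum, Matrix.mul_apply]
      refine Finset.sum_congr rfl fun k _ => ?_
      rw [map_smul, inner_smul_right]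
      rfl
    -- The two functions are the entries of `π(x g)` and `π(g x)`; conjugating `x` by `g` carries
    -- the first to the second, and a class function does not see the conjugation.
    rw [h1, h2, ← hconj g]
    congr 2
    ext x
    rw [ContinuousMap.sum_apply]
    change (∑ k, π.mat g k j • π.coef i k) (g * x * g⁻¹) = _
    have h3 := congrFun (congrFun (π.mat_mul (g * x * g⁻¹) g) i) j
    rw [inv_mul_cancel_right, π.mat_mul, Matrix.mul_apply, Matrix.mul_apply] at h3
    rw [ContinuousMap.sum_apply]
    simpa [mul_comm] using h3.symm
  have htr : H.trace = 0 := by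
    rw [← h, π.character_eq_sum, _root_.map_sum, inner_sum]
    rfl
  have hH : H = 0 := by
    rw [UnitaryIrrep.eq_trace_div_smul_one hcomm, htr, zero_div, zero_smul]
  exact congrFun (congrFun hH i) j

theorem eq_zero_of_inner_character_eq_zero {f : L2 G} (hf : f ∈ L2c G)
    (h : ∀ π : UnitaryDual G, inner ℂ f (toL2 π.character) = 0) : f = 0 := by
  rw [← Submodule.mem_bot ℂ, ← coefSpan_orthogonal, Submodule.mem_orthogonal']
  intro u hu
  refine Submodule.span_induction (p := fun u _ => inner ℂ f u = 0) ?_ (inner_zero_right _)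
    (fun u v _ _ hu hv => by rw [inner_add_right, hu, hv, add_zero])
    (fun c u _ hu => by rw [inner_smul_right, hu, mul_zero]) hu
  rintro _ ⟨π, i, j, rfl⟩
  exact inner_coef_eq_zero_of_inner_character hf π (h (UnitaryDual.mk π)) i j

/-- The characters are complete in `L²_c(G)`. -/
theorem span_character_topologicalClosure :
    (Submodule.span ℂ
      (Set.range fun π : UnitaryDual G => toL2 π.character)).topologicalClosure = L2c G := by
  set K := (Submodule.span ℂ
    (Set.range fun π : UnitaryDual G => toL2 π.character)).topologicalClosure with hK
  have hle : K ≤ L2c G := by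
    refine Submodule.topologicalClosure_minimal _ (Submodule.span_le.mpr ?_) isClosed_L2c
    rintro _ ⟨⟨π⟩, rfl⟩
    exact character_mem_L2c π
  have : CompleteSpace K := (Submodule.isClosed_topologicalClosure _).completeSpace_coe
  have hbot : Kᗮ ⊓ L2c G = ⊥ := by
    rw [eq_bot_iff]
    rintro f ⟨hf, hfc⟩
    refine (Submodule.mem_bot ℂ).mpr (eq_zero_of_inner_character_eq_zero hfc fun π => ?_)
    exact (Submodule.mem_orthogonal' _ _).mp hf _
      (Submodule.le_topologicalClosure _ (Submodule.subset_span ⟨π, rfl⟩))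
  have h := Submodule.sup_orthogonal_inf_of_hasOrthogonalProjection hle
  rwa [hbot, sup_bot_eq] at h

end Completeness

end CompactHunt

open CompactHunt in
theorem theorem5p2 {G : Type*} [Group G] [TopologicalSpace G] [IsTopologicalGroup G]
    [CompactSpace G] [T2Space G] [MeasurableSpace G] [BorelSpace G]
    (μ : ℝ≥0 → ProbabilityMeasure G) (hμ : IsConvolutionSemigroup μ)
    (hcentral : ∀ t, IsCentral (μ t : Measure G))
    (hsymm : ∀ t, IsSymmetric (μ t : Measure G)) :
    ∃ α : UnitaryDual G → ℝ,
      (∀ π, α π ≤ 0) ∧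
      -- the numbers `α π` are those given by the Fourier transforms of the measures
      (∀ (t : ℝ≥0) (π : UnitaryIrrep G),
        π.fourier (μ t : Measure G) = Complex.exp (t * α (UnitaryDual.mk π)) • 1) ∧
      -- `T_t` acts on `L²_c(G)`
      (∀ (t : ℝ≥0), ∀ f ∈ L2c G, hunt (μ t) f ∈ L2c G) ∧
      -- the characters are eigenvectors of `T_t` in `L²_c(G)`
      (∀ π : UnitaryDual G, toL2 π.character ∈ L2c G) ∧
      (∀ (t : ℝ≥0) (π : UnitaryDual G),
        hunt (μ t) (toL2 π.character) = Complex.exp (t * α π) • toL2 π.character) ∧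
      -- completeness: they form an orthonormal basis of `L²_c(G)`
      Orthonormal ℂ (fun π : UnitaryDual G => toL2 π.character) ∧
      (Submodule.span ℂ (Set.range fun π : UnitaryDual G => toL2 π.character)).topologicalClosure =
        L2c G := by
  have hex : ∀ π : UnitaryDual G, ∃ a : ℝ, a ≤ 0 ∧
      ∀ t, multiplier (μ t : Measure G) π.character = Complex.exp (t * a) := by
    rintro ⟨π⟩
    exact exists_multiplier_eq_exp hμ hcentral hsymm π
  choose α hα hexp using hex
  refine ⟨α, hα, fun t π => ?_, fun t f hf => hunt_mem_L2c (hcentral t) hf, ?_, ?_,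
    orthonormal_character, span_character_topologicalClosure⟩
  · rw [← hexp]
    exact π.fourier_eq_smul_one (hcentral t)
  · rintro ⟨π⟩
    exact character_mem_L2c π
  · intro t π
    rw [← hexp]
    obtain ⟨π⟩ := π
    exact hunt_character (hcentral t) π
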